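/- Fix a first-order vocabulary $\Sigma$ with predicate and constant symbols (exogenous function symbols may be allowed as well). An *E-disjunctive program* $\mathcal P$ is a finite set of rules $$\forall \bar x:\exists \bar y:\ \alpha_1;\dots;\alpha_m \ \text{:-}\ \beta_1,\dots,\beta_k,\ \text{not}\,\gamma_1,\dots,\text{not}\,\gamma_n \qquad (m,k,n\ge 0),$$ where the $\alpha_i,\beta_i,\gamma_i$ are atoms of $\Sigma$ whose variables are among $\bar x,\bar y$, and the variables in $\bar y$ occur only in the $\alpha_i$. Rules with $m=0$ are called *constraints*. The program is *without recursion over negation* if its predicate dependency graph (with an edge from every head predicate of a rule to every predicate in the body of that rule, negative if the latter occurs there under "not") has no cycle that contains a negative edge. No non-overlapping condition is imposed on $\mathcal P$. Let $\mathcal M$ be a $\Sigma$-structure with non-empty domain, identified with its set of true domain atoms, and let $\mathcal M^-=\{\lnot\alpha \mid \alpha \text{ a domain atom false in } \mathcal M\}$. The structure $\mathcal M$ is a *stable model* of $\mathcal P$ if it is a $\subseteq$-minimal set $X$ such that for every rule $r\in\mathcal P$ and every assignment $\eta$ of $\bar x$: if $X\cup\mathcal M^-$ logically entails $body(r)\eta$,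 then for some assignment $\theta$ of $\bar y$ and some $\alpha_i$ in the head of $r$, $\alpha_i\eta\theta\in X$. The corresponding FO(C-Log) theory $\mathcal T_{\mathcal P}$ consists of - the C-Log causal theory that is the **And**-conjunction of the expressions $\textbf{All}\ \bar x\,[\beta_1\land\dots\land\beta_k\land\lnot\gamma_1\land\dots\land\lnot\gamma_n]:\ \textbf{Select}\ \bar y\,[\mathbf t]:\ \alpha_1\ \textbf{Or}\ \dots\ \textbf{Or}\ \alpha_m$ for the rules of $\mathcal P$ with $m>0$ (there is no causal theory if there are no such rules); - the sentences $\forall\bar x:\lnot(\beta_1\land\dots\land\beta_k\land\lnot\gamma_1\land\dots\land\lnot\gamma_n)$ for the constraints of $\mathcal P$; - the sentences $\forall\bar z:\lnot P(\bar z)$ for the predicates $P$ of $\Sigma$ that occur in the head of no rule of $\mathcal P$. A structure $\mathcal M$ is a model of $\mathcal T_{\mathcal P}$ if it satisfies these sentences and is a model of the causal theory $\Delta$. The latter means that there is a selection $\zeta$ (for every occurrence of **Or**, respectively **Select**, in $\Delta$ and all values of the variables in whose scope it stands, a disjunct, respectively a domain element satisfying the qualification) such that $\mathcal M$ is the two-valued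 well-founded fixpoint of the three-valued immediate causality operator of $\Delta$ under $\zeta$; here the predicates that are not caused by any atom-expression of $\Delta$ are fixed as in $\mathcal M$. **Theorem.** Let $\mathcal P$ be any E-disjunctive program without recursion over negation and $\mathcal T_{\mathcal P}$ the corresponding FO(C-Log) theory. Then every stable model of $\mathcal P$ is a model of $\mathcal T_{\mathcal P}$. The converse fails, as C-Log imposes no global minimality: there are an E-disjunctive program $\mathcal P$ without recursion over negation and structures $\mathcal M_0$, $\mathcal M$ with the same domain and the same interpretation of constants, such that both are models of $\mathcal T_{\mathcal P}$, the domain atoms true in $\mathcal M_0$ form a proper subset of those true in $\mathcal M$, and $\mathcal M$ is not a stable model of $\mathcal P$. -/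

import Mathlib

universe u v w

namespace CLog

open scoped FirstOrder

/-- An atom `P(t₁, …, tₖ)` over the vocabulary `L` whose variables are among `x₀, …, xₙ₋₁`.
Variables are well-scoped de Bruijn levels, as in Mathlib's `BoundedFormula`. -/
structure Atom (L : FirstOrder.Language.{u, v}) (n : ℕ) where
  arity : ℕ
  pred : L.Relations arity
  args : Fin arity → L.Term (Empty ⊕ Fin n)

/-- A domain atom `P(d₁, …, dₖ)`, where the `dᵢ` are elements of the domain `D`. -/
structure DomainAtom (L : FirstOrder.Language.{u, v}) (D : Type w) where
  arity : ℕ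
  pred : L.Relations arity
  args : Fin arity → D

/-- The predicate symbols of a vocabulary, with their arities. -/
abbrev Pred (L : FirstOrder.Language.{u, v}) : Type v := Σ k : ℕ, L.Relations k

/-- The predicate symbol of an atom. -/
def Atom.symbol {L : FirstOrder.Language.{u, v}} {n : ℕ} (A : Atom L n) : Pred L := ⟨A.arity, A.pred⟩

/-- The predicate symbol of a domain atom. -/
def DomainAtom.symbol {L : FirstOrder.Language.{u, v}} {D : Type w} (a : DomainAtom L D) : Pred L :=
  ⟨a.arity, a.pred⟩

/-- An atom as a first-order formula. -/
def Atom.toFormula {L : FirstOrder.Language.{u, v}} {n : ℕ} (A : Atom L n) : L.BoundedFormula Empty n :=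
  A.pred.boundedFormula A.args

/-- The domain atom obtained from an atom by evaluating its terms under the assignment `x`. -/
def Atom.eval {L : FirstOrder.Language.{u, v}} {D : Type w} (M : L.Structure D) {n : ℕ} (A : Atom L n)
    (x : Fin n → D) : DomainAtom L D :=
  ⟨A.arity, A.pred, fun i => (A.args i).realize (Sum.elim default x)⟩

/-- The set of domain atoms that are true in the structure `M`. -/
def atoms {L : FirstOrder.Language.{u, v}} {D : Type w} (M : L.Structure D) : Set (DomainAtom L D) :=
  {a | M.RelMap a.pred a.args}

/-! ### Creation-free causal effect expressions -/

/-- Creation-free causal effect expressions with free variables among `x₀, …, xₙ₋₁`.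
The operators `all` and `select` bind the variable `xₙ` in their qualification (the
first-order formula) and in their assertion. -/
inductive CEE (L : FirstOrder.Language.{u, v}) : ℕ → Type (max u v)
  /-- The atom-expression `P(t)`. -/
  | atom {n : ℕ} (A : Atom L n) : CEE L n
  /-- The rule expression `C ← φ`. -/
  | cond {n : ℕ} (φ : L.BoundedFormula Empty n) (C : CEE L n) : CEE L n
  /-- The expression `C₁ And C₂`. -/
  | and {n : ℕ} (C₁ C₂ : CEE L n) : CEE L n
  /-- The expression `C₁ Or C₂`. -/
  | or {n : ℕ} (C₁ C₂ : CEE L n) : CEE L n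
  /-- The expression `All x[φ]: C`. -/
  | all {n : ℕ} (φ : L.BoundedFormula Empty (n + 1)) (C : CEE L (n + 1)) : CEE L n
  /-- The expression `Select x[φ]: C`. -/
  | select {n : ℕ} (φ : L.BoundedFormula Empty (n + 1)) (C : CEE L (n + 1)) : CEE L n

/-- A causal theory is a causal effect expression without free variables. -/
abbrev CausalTheory (L : FirstOrder.Language.{u, v}) : Type (max u v) := CEE L 0

/-- The predicate symbols that are endogenous in an expression: those that occur as the symbol
of a (possibly nested) atom-expression. -/
def CEE.endogenous {L : FirstOrder.Language.{u, v}} : {n : ℕ} → CEE L n → Set (Pred L)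
  | _, .atom A => {A.symbol}
  | _, .cond _ C => C.endogenous
  | _, .and C₁ C₂ => C₁.endogenous ∪ C₂.endogenous
  | _, .or C₁ C₂ => C₁.endogenous ∪ C₂.endogenous
  | _, .all _ C => C.endogenous
  | _, .select _ C => C.endogenous

/-- A selection for an expression resolves its non-determinism: it provides, for every
occurrence of an `Or`- or a `Select`-expression, a function that maps the values of the
variables in whose scope the occurrence stands to the chosen disjunct (`true` for the left one),
respectively to the chosen domain element. -/
def CEE.Selection {L : FirstOrder.Language.{u, v}} (D : Type w) : {n : ℕ} → CEE L n → Type w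
  | _, .atom _ => PUnit
  | _, .cond _ C => C.Selection D
  | _, .and C₁ C₂ => C₁.Selection D × C₂.Selection D
  | n, .or C₁ C₂ => ((Fin n → D) → Bool) × C₁.Selection D × C₂.Selection D
  | _, .all _ C => C.Selection D
  | n, .select _ C => ((Fin n → D) → D) × C.Selection D

/-! ### Three-valued evaluation

A partial structure is a pair `(l, u)` of sets of domain atoms: the atoms in `l` are certainly
true, those outside of `u` are certainly false, the others are unknown. Domain and function
(constant) symbols are interpreted by the structure `M`. -/

/-- Kleene's three-valued truth of first-order formulas: predicates are read in `p` at
positive occurrences and in `q` at negative ones. In a partial structure `(l, u)`, the formula is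
(certainly) true if `Holds M φ l u`, and it is not false (true or unknown) if `Holds M φ u l`. -/
def Holds {L : FirstOrder.Language.{u, v}} {D : Type w} (M : L.Structure D) :
    {n : ℕ} → L.BoundedFormula Empty n → Set (DomainAtom L D) → Set (DomainAtom L D) →
      (Fin n → D) → Prop
  | _, .falsum, _, _, _ => False
  | _, .equal t₁ t₂, _, _, x =>
      t₁.realize (Sum.elim default x) = t₂.realize (Sum.elim default x)
  | _, .rel R ts, p, _, x => (⟨_, R, fun i => (ts i).realize (Sum.elim default x)⟩ :
      DomainAtom L D) ∈ p
  | _, .imp φ ψ, p, q, x => Holds M φ q p x → Holds M ψ p q x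
  | _, .all φ, p, q, x => ∀ d : D, Holds M φ p q (Fin.snoc x d)

/-- The effect set of an expression for a selection. In a partial structure `(l, u)`, the set
`C.effects M ζ l u x` contains the atoms that are certainly caused, and `C.effects M ζ u l x`
those that are possibly caused. -/
def CEE.effects {L : FirstOrder.Language.{u, v}} {D : Type w} (M : L.Structure D) :
    {n : ℕ} → (C : CEE L n) → C.Selection D → Set (DomainAtom L D) → Set (DomainAtom L D) →
      (Fin n → D) → Set (DomainAtom L D)
  | _, .atom A, _, _, _, x => {A.eval M x}
  | _, .cond φ C, ζ, p, q, x => {a | Holds M φ p q x ∧ a ∈ C.effects M ζ p q x}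
  | _, .and C₁ C₂, ζ, p, q, x => C₁.effects M ζ.1 p q x ∪ C₂.effects M ζ.2 p q x
  | _, .or C₁ C₂, ζ, p, q, x =>
      match ζ.1 x with
      | true => C₁.effects M ζ.2.1 p q x
      | false => C₂.effects M ζ.2.2 p q x
  | _, .all φ C, ζ, p, q, x =>
      {a | ∃ d : D, Holds M φ p q (Fin.snoc x d) ∧ a ∈ C.effects M ζ p q (Fin.snoc x d)}
  | _, .select φ C, ζ, p, q, x =>
      {a | Holds M φ p q (Fin.snoc x (ζ.1 x)) ∧ a ∈ C.effects M ζ.2 p q (Fin.snoc x (ζ.1 x))}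

/-- Every `Select`-expression that takes effect in the structure `M` selects an element that
satisfies its qualification in `M`. -/
def CEE.SelectsProperly {L : FirstOrder.Language.{u, v}} {D : Type w} (M : L.Structure D) :
    {n : ℕ} → (C : CEE L n) → C.Selection D → (Fin n → D) → Prop
  | _, .atom _, _, _ => True
  | _, .cond φ C, ζ, x => φ.Realize default x → C.SelectsProperly M ζ x
  | _, .and C₁ C₂, ζ, x => C₁.SelectsProperly M ζ.1 x ∧ C₂.SelectsProperly M ζ.2 x
  | _, .or C₁ C₂, ζ, x =>
      match ζ.1 x with
      | true => C₁.SelectsProperly M ζ.2.1 x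
      | false => C₂.SelectsProperly M ζ.2.2 x
  | _, .all φ C, ζ, x =>
      ∀ d : D, φ.Realize default (Fin.snoc x d) → C.SelectsProperly M ζ (Fin.snoc x d)
  | _, .select φ C, ζ, x =>
      φ.Realize default (Fin.snoc x (ζ.1 x)) ∧ C.SelectsProperly M ζ.2 (Fin.snoc x (ζ.1 x))

theorem Holds.mono {L : FirstOrder.Language.{u, v}} {D : Type w} (M : L.Structure D) {n : ℕ}
    (φ : L.BoundedFormula Empty n) :
    ∀ {p p' q q' : Set (DomainAtom L D)} {x : Fin n → D}, p ⊆ p' → q' ⊆ q →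
      Holds M φ p q x → Holds M φ p' q' x := by
  induction φ with
  | falsum => intro _ _ _ _ _ _ _ h; exact h
  | equal t₁ t₂ => intro _ _ _ _ _ _ _ h; exact h
  | rel R ts => intro _ _ _ _ _ hp _ h; exact hp h
  | imp φ ψ ih₁ ih₂ => intro _ _ _ _ _ hp hq h h'; exact ih₂ hp hq (h (ih₁ hq hp h'))
  | all φ ih => intro _ _ _ _ _ hp hq h d; exact ih hp hq (h d)

theorem CEE.effects_mono {L : FirstOrder.Language.{u, v}} {D : Type w} (M : L.Structure D) {n : ℕ}
    (C : CEE L n) :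
    ∀ (ζ : C.Selection D) {p p' q q' : Set (DomainAtom L D)} (x : Fin n → D), p ⊆ p' → q' ⊆ q →
      C.effects M ζ p q x ⊆ C.effects M ζ p' q' x := by
  induction C with
  | atom A => intro ζ _ _ _ _ x _ _; exact subset_rfl
  | cond φ C ih =>
    intro ζ _ _ _ _ x hp hq a h
    exact ⟨Holds.mono M φ hp hq h.1, ih ζ x hp hq h.2⟩
  | and C₁ C₂ ih₁ ih₂ =>
    intro ζ _ _ _ _ x hp hq
    exact Set.union_subset_union (ih₁ ζ.1 x hp hq) (ih₂ ζ.2 x hp hq)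
  | or C₁ C₂ ih₁ ih₂ =>
    intro ζ _ _ _ _ x hp hq
    simp only [CEE.effects]
    split
    · exact ih₁ _ x hp hq
    · exact ih₂ _ x hp hq
  | all φ C ih =>
    rintro ζ _ _ _ _ x hp hq a ⟨d, h₁, h₂⟩
    exact ⟨d, Holds.mono M φ hp hq h₁, ih ζ _ hp hq h₂⟩
  | select φ C ih =>
    intro ζ _ _ _ _ x hp hq a h
    exact ⟨Holds.mono M φ hp hq h.1, ih ζ.2 _ hp hq h.2⟩

/-! ### Models of causal theories -/

/-- The immediate causality operator for a selection: exogenous predicates keep the value that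
they have in `M`, and an endogenous atom is true if and only if it is caused. A partial structure
`(l, u)` is sent to the pair of `step M Δ ζ l u` and `step M Δ ζ u l`. -/
def step {L : FirstOrder.Language.{u, v}} {D : Type w} (M : L.Structure D) (Δ : CausalTheory L)
    (ζ : Δ.Selection D) (p q : Set (DomainAtom L D)) : Set (DomainAtom L D) :=
  {a | a.symbol ∉ Δ.endogenous ∧ a ∈ atoms M} ∪ Δ.effects M ζ p q default

theorem step_mono {L : FirstOrder.Language.{u, v}} {D : Type w} (M : L.Structure D) (Δ : CausalTheory L)
    (ζ : Δ.Selection D) {p p' q q' : Set (DomainAtom L D)} (hp : p ⊆ p') (hq : q' ⊆ q) :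
    step M Δ ζ p q ⊆ step M Δ ζ p' q' :=
  Set.union_subset_union_right _ (CEE.effects_mono M Δ ζ _ hp hq)

/-- The least set of atoms that is closed under the immediate causality operator, when negative
occurrences of atoms are evaluated in `q`. -/
def stableStep {L : FirstOrder.Language.{u, v}} {D : Type w} (M : L.Structure D) (Δ : CausalTheory L)
    (ζ : Δ.Selection D) (q : Set (DomainAtom L D)) : Set (DomainAtom L D) :=
  OrderHom.lfp ⟨fun p => step M Δ ζ p q, fun _ _ hp => step_mono M Δ ζ hp subset_rfl⟩

theorem stableStep_anti {L : FirstOrder.Language.{u, v}} {D : Type w} (M : L.Structure D)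
    (Δ : CausalTheory L) (ζ : Δ.Selection D) {q q' : Set (DomainAtom L D)} (hq : q' ⊆ q) :
    stableStep M Δ ζ q ⊆ stableStep M Δ ζ q' :=
  OrderHom.lfp.monotone (fun _ => step_mono M Δ ζ subset_rfl hq)

/-- The stable revision operator `(l, u) ↦ (stableStep u, stableStep l)` on partial structures,
which are ordered by precision. -/
def stableRevision {L : FirstOrder.Language.{u, v}} {D : Type w} (M : L.Structure D) (Δ : CausalTheory L)
    (ζ : Δ.Selection D) :
    Set (DomainAtom L D) × (Set (DomainAtom L D))ᵒᵈ →o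
      Set (DomainAtom L D) × (Set (DomainAtom L D))ᵒᵈ where
  toFun I := (stableStep M Δ ζ (OrderDual.ofDual I.2), OrderDual.toDual (stableStep M Δ ζ I.1))
  monotone' _ _ h := ⟨stableStep_anti M Δ ζ h.2, stableStep_anti M Δ ζ h.1⟩

/-- The partial structure in which the causal processes described by `Δ` end for the selection
`ζ`: the well-founded fixpoint of the immediate causality operator, i.e. the least precise
fixpoint of the stable revision operator. -/
def wellFounded {L : FirstOrder.Language.{u, v}} {D : Type w} (M : L.Structure D) (Δ : CausalTheory L)
    (ζ : Δ.Selection D) : Set (DomainAtom L D) × (Set (DomainAtom L D))ᵒᵈ :=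
  OrderHom.lfp (stableRevision M Δ ζ)

/-- `M` is a model of the causal theory `Δ`: for some selection, which only selects elements that
satisfy the respective qualification, the well-founded fixpoint is two-valued and equal to `M`. -/
def CEE.IsModel {L : FirstOrder.Language.{u, v}} {D : Type w} (Δ : CausalTheory L) (M : L.Structure D) :
    Prop :=
  ∃ ζ : Δ.Selection D,
    wellFounded M Δ ζ = (atoms M, OrderDual.toDual (atoms M)) ∧ Δ.SelectsProperly M ζ default

/-- A theory of first-order logic extended with causal theories. -/
structure FOCLogTheory (L : FirstOrder.Language.{u, v}) where
  causal : Set (CausalTheory L)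
  sentences : L.Theory

/-- `M` is a model of each of the causal theories and of each of the sentences. -/
def FOCLogTheory.IsModel {L : FirstOrder.Language.{u, v}} {D : Type w} (T : FOCLogTheory L)
    (M : L.Structure D) : Prop :=
  (∀ Δ ∈ T.causal, Δ.IsModel M) ∧ ∀ φ ∈ T.sentences, FirstOrder.Language.Sentence.Realize D φ

/-! ### E-disjunctive logic programs -/

/-- A rule `∀ x̄ : ∃ ȳ : α₁; …; αₘ :- β₁, …, βₖ, not γ₁, …, not γₗ`, where `x̄` has length `nx` and
`ȳ` has length `ny`. In the head, the first `nx` variables are `x̄` and the remaining ones are `ȳ`;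
the body has no variables but `x̄`. -/
structure Rule (L : FirstOrder.Language.{u, v}) where
  nx : ℕ
  ny : ℕ
  head : List (Atom L (nx + ny))
  pos : List (Atom L nx)
  neg : List (Atom L nx)

/-- E-disjunctive programs are finite sets of rules. -/
abbrev Program (L : FirstOrder.Language.{u, v}) : Type (max u v) := Finset (Rule L)

/-- The literal set `X ∪ M⁻`, where `M⁻` consists of the negations of all domain atoms that are
false in `M`, logically entails the instance of the body of `r` under the assignment `x`: the
body holds in every interpretation `J` (a set of true domain atoms) that satisfies `X ∪ M⁻`. -/
def EntailsBody {L : FirstOrder.Language.{u, v}} {D : Type w} (M : L.Structure D) (X : Set (DomainAtom L D))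
    (r : Rule L) (x : Fin r.nx → D) : Prop :=
  ∀ J : Set (DomainAtom L D), (∀ a ∈ X, a ∈ J) → (∀ a, a ∉ atoms M → a ∉ J) →
    (∀ B ∈ r.pos, B.eval M x ∈ J) ∧ ∀ G ∈ r.neg, G.eval M x ∉ J

/-- The closure condition in the definition of stable models: whenever `X ∪ M⁻` entails the
instance of a body, `X` contains an instance of one of the head atoms. -/
def Satisfies {L : FirstOrder.Language.{u, v}} {D : Type w} (P : Program L) (M : L.Structure D)
    (X : Set (DomainAtom L D)) : Prop :=
  ∀ r ∈ P, ∀ x : Fin r.nx → D, EntailsBody M X r x →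
    ∃ y : Fin r.ny → D, ∃ A ∈ r.head, A.eval M (Fin.append x y) ∈ X

/-- `M` is a stable model of `P`: it is a minimal set that satisfies the closure condition. -/
def IsStableModel {L : FirstOrder.Language.{u, v}} {D : Type w} (P : Program L) (M : L.Structure D) : Prop :=
  Minimal (Satisfies P M) (atoms M)

/-- The predicate `s` occurs in the body of a rule of `P` whose head contains the predicate `h`. -/
def DependsOn {L : FirstOrder.Language.{u, v}} (P : Program L) (h s : Pred L) : Prop :=
  ∃ r ∈ P, (∃ A ∈ r.head, A.symbol = h) ∧ ((∃ B ∈ r.pos, B.symbol = s) ∨ ∃ G ∈ r.neg, G.symbol = s)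

/-- The predicate `s` occurs negated in the body of a rule of `P` whose head contains `h`. -/
def DependsNegativelyOn {L : FirstOrder.Language.{u, v}} (P : Program L) (h s : Pred L) : Prop :=
  ∃ r ∈ P, (∃ A ∈ r.head, A.symbol = h) ∧ ∃ G ∈ r.neg, G.symbol = s

/-- Recursion over negation: a cycle of the predicate dependency graph with a negative edge. -/
def RecursionOverNegation {L : FirstOrder.Language.{u, v}} (P : Program L) : Prop :=
  ∃ h s : Pred L, DependsNegativelyOn P h s ∧ Relation.ReflTransGen (DependsOn P) s h

/-! ### The theory that corresponds to a program -/

/-- The body of a rule as a first-order formula `β₁ ∧ … ∧ βₖ ∧ ¬γ₁ ∧ … ∧ ¬γₗ`. -/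
def Rule.body {L : FirstOrder.Language.{u, v}} (r : Rule L) : L.BoundedFormula Empty r.nx :=
  (r.pos.map Atom.toFormula ++ r.neg.map fun G => ∼G.toFormula).foldr (· ⊓ ·) ⊤

/-- `α₁ Or (α₂ Or …)`, for a non-empty list of atoms. -/
def orAtoms {L : FirstOrder.Language.{u, v}} {n : ℕ} : Atom L n → List (Atom L n) → CEE L n
  | A, [] => .atom A
  | A, B :: As => .or (.atom A) (orAtoms B As)

/-- `C₁ And (C₂ And …)`, for a non-empty list of expressions. -/
def andList {L : FirstOrder.Language.{u, v}} {n : ℕ} : CEE L n → List (CEE L n) → CEE L n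
  | C, [] => C
  | C, C' :: Cs => .and C (andList C' Cs)

/-- `Select ȳ[t]: C`, an abbreviation for `Select y₁[t]: … Select yₖ[t]: C`. -/
def selectMany {L : FirstOrder.Language.{u, v}} {n : ℕ} : (k : ℕ) → CEE L (n + k) → CEE L n
  | 0, C => C
  | k + 1, C => selectMany k (.select ⊤ C)

/-- `All x₁[t]: … All xₙ[t]: C`. -/
def allTrue {L : FirstOrder.Language.{u, v}} : (n : ℕ) → CEE L n → CEE L 0
  | 0, C => C
  | n + 1, C => allTrue n (.all ⊤ C)

/-- `All x̄[φ]: C`, an abbreviation for `All x₁[t]: … All xₙ[φ]: C`; if there are no variables,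
this is `C ← φ`. -/
def allMany {L : FirstOrder.Language.{u, v}} : (n : ℕ) → L.BoundedFormula Empty n → CEE L n → CEE L 0
  | 0, φ, C => .cond φ C
  | n + 1, φ, C => allTrue n (.all φ C)

/-- The causal effect expression `All x̄[body]: Select ȳ[t]: α₁ Or … Or αₘ` of a rule with `m > 0`;
a constraint has none. -/
def Rule.toCEE? {L : FirstOrder.Language.{u, v}} (r : Rule L) : Option (CausalTheory L) :=
  match r.head with
  | [] => none
  | A :: As => some (allMany r.nx r.body (selectMany r.ny (orAtoms A As)))

/-- The conjunction of the expressions of all rules of `P` that are not constraints, if there are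
such rules. -/
noncomputable def causalPart {L : FirstOrder.Language.{u, v}} (P : Program L) : Set (CausalTheory L) :=
  match P.toList.filterMap Rule.toCEE? with
  | [] => ∅
  | C :: Cs => {andList C Cs}

/-- The sentence `∀ x̄ : ¬ (β₁ ∧ … ∧ βₖ ∧ ¬γ₁ ∧ … ∧ ¬γₗ)` of a constraint. -/
def Rule.constraint {L : FirstOrder.Language.{u, v}} (r : Rule L) : L.Sentence := (∼r.body).alls

/-- The sentence `∀ x̄ : ¬ P(x̄)`. -/
def isEmptySentence {L : FirstOrder.Language.{u, v}} (s : Pred L) : L.Sentence :=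
  (∼(s.2.boundedFormula fun i => FirstOrder.Language.Term.var (Sum.inr i)) :
    L.BoundedFormula Empty s.1).alls

/-- The theory that corresponds to the program `P`. -/
noncomputable def correspondingTheory {L : FirstOrder.Language.{u, v}} (P : Program L) : FOCLogTheory L where
  causal := causalPart P
  sentences :=
    {φ | ∃ r ∈ P, r.head = [] ∧ φ = r.constraint} ∪
      {φ | ∃ s : Pred L, (∀ r ∈ P, ∀ A ∈ r.head, A.symbol ≠ s) ∧ φ = isEmptySentence s}

end CLog

namespace CLog

open FirstOrder FirstOrder.Language

variable {L : FirstOrder.Language.{u, v}} {D : Type w}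

/-! ### Truth of formulas and of rule bodies -/

/-! Resolving all non-determinism of the theory amounts to a choice `c` of one head instance for
every instance of a rule with non-empty head; the `exists_selection_*` lemmas turn any such `c` into
a selection whose effects are exactly the chosen atoms of the firing instances.

If `M` is stable, choose head instances that are true in `M` wherever the body holds in `M`. The
least set closed under the chosen instances, with negation evaluated in `M`, lies inside `M` and
satisfies the closure condition of the program, so by minimality it is all of `M`. Hence `(M, M)` is
a fixpoint of the stable revision operator, and it remains to see that it is the least precise one.
This is where the absence of recursion over negation enters: by induction along dependencies through
negation, every fixpoint `(l, u)` has `u ⊆ l` (`subset_of_stableStep_eq`), and the well-founded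
fixpoint encloses `M`, so it is `(M, M)`.

The converse fails because distinct instances of one rule may select distinct witnesses where a
single witness would do. -/

theorem holds_atoms_iff_realize (M : L.Structure D) {n : ℕ} (φ : L.BoundedFormula Empty n)
    (x : Fin n → D) : Holds M φ (atoms M) (atoms M) x ↔ φ.Realize default x := by
  induction φ with
  | falsum => exact Iff.rfl
  | equal t₁ t₂ => exact Iff.rfl
  | rel R ts => exact Iff.rfl
  | imp φ ψ ih₁ ih₂ => exact imp_congr (ih₁ x) (ih₂ x)
  | all φ ih => exact forall_congr' fun d => ih _

theorem holds_top (M : L.Structure D) {n : ℕ} (p q : Set (DomainAtom L D)) (x : Fin n → D) :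
    Holds M (⊤ : L.BoundedFormula Empty n) p q x :=
  fun h => h

theorem holds_inf (M : L.Structure D) {n : ℕ} (φ ψ : L.BoundedFormula Empty n)
    (p q : Set (DomainAtom L D)) (x : Fin n → D) :
    Holds M (φ ⊓ ψ) p q x ↔ Holds M φ p q x ∧ Holds M ψ p q x := by
  -- The conjunction is encoded as `¬(φ → ¬ψ)`: each conjunct sits under two premise positions, so
  -- the two swaps of `p` and `q` cancel.
  change ((Holds M φ p q x → Holds M ψ p q x → False) → False) ↔ _
  tauto

theorem holds_foldr_inf (M : L.Structure D) {n : ℕ} (l : List (L.BoundedFormula Empty n))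
    (p q : Set (DomainAtom L D)) (x : Fin n → D) :
    Holds M (l.foldr (· ⊓ ·) ⊤) p q x ↔ ∀ φ ∈ l, Holds M φ p q x := by
  induction l with
  | nil => simpa using holds_top M p q x
  | cons φ l ih => rw [List.foldr_cons, holds_inf, ih, List.forall_mem_cons]

/-- The instance of the body of `r` under `x` holds when positive atoms are evaluated in `p` and
negated ones in `q`. -/
def Rule.Fires (M : L.Structure D) (r : Rule L) (p q : Set (DomainAtom L D))
    (x : Fin r.nx → D) : Prop :=
  (∀ B ∈ r.pos, B.eval M x ∈ p) ∧ ∀ G ∈ r.neg, G.eval M x ∉ q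

theorem holds_body (M : L.Structure D) (r : Rule L) (p q : Set (DomainAtom L D))
    (x : Fin r.nx → D) : Holds M r.body p q x ↔ r.Fires M p q x := by
  rw [Rule.body, holds_foldr_inf]
  simp only [List.forall_mem_append, List.forall_mem_map]
  exact Iff.rfl

/-- Two extreme interpretations decide entailment: `X` for the positive atoms and `atoms M` for the
negated ones. The inclusion `X ⊆ atoms M` makes both of them satisfy the literal set. -/
theorem entailsBody_iff_fires (M : L.Structure D) {X : Set (DomainAtom L D)} (hX : X ⊆ atoms M)
    (r : Rule L) (x : Fin r.nx → D) : EntailsBody M X r x ↔ r.Fires M X (atoms M) x := by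
  constructor
  · intro h
    exact ⟨(h X (fun _ => id) fun a ha ha' => ha (hX ha')).1,
      (h (atoms M) (fun _ => @hX _) fun _ => id).2⟩
  · intro h J hJ hJ'
    exact ⟨fun B hB => hJ _ (h.1 B hB), fun G hG => hJ' _ (h.2 G hG)⟩

theorem Rule.Fires.mono {M : L.Structure D} {r : Rule L} {p p' q q' : Set (DomainAtom L D)}
    {x : Fin r.nx → D} (h : r.Fires M p q x) (hp : p ⊆ p') (hq : q' ⊆ q) : r.Fires M p' q' x :=
  ⟨fun B hB => hp (h.1 B hB), fun G hG hG' => h.2 G hG (hq hG')⟩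

/-! ### Selections that realize a choice of head instances -/

theorem exists_selection_orAtoms (M : L.Structure D) {n : ℕ} (A : Atom L n) (As : List (Atom L n))
    (f : (Fin n → D) → Atom L n) (hf : ∀ z, f z ∈ A :: As) :
    ∃ ζ : (orAtoms A As).Selection D, ∀ z,
      (∀ p q, (orAtoms A As).effects M ζ p q z = {(f z).eval M z}) ∧
        (orAtoms A As).SelectsProperly M ζ z := by
  classical
  induction As generalizing A f with
  | nil =>
    refine ⟨PUnit.unit, fun z => ⟨fun p q => ?_, trivial⟩⟩
    rw [List.mem_singleton.1 (hf z)]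
    rfl
  | cons B As ih =>
    -- Where `f` picks `A`, the tail of the disjunction is never reached; `B` is a dummy value that
    -- keeps the choice inside `B :: As`.
    obtain ⟨ζ, hζ⟩ := ih B (fun z => if f z = A then B else f z) fun z => by
      by_cases h : f z = A
      · simp [h]
      · simpa [h] using hf z
    refine ⟨(fun z => decide (f z = A), PUnit.unit, ζ), fun z => ?_⟩
    by_cases h : f z = A
    · constructor
      · intro p q
        simp [orAtoms, CEE.effects, h]
      · simp [orAtoms, CEE.SelectsProperly, h]
    · have := hζ z
      simp only [h, if_false] at this
      constructor
      · intro p q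
        simpa [orAtoms, CEE.effects, h] using this.1 p q
      · simpa [orAtoms, CEE.SelectsProperly, h] using this.2

theorem exists_selection_selectMany (M : L.Structure D) {n k : ℕ} (C : CEE L (n + k))
    (ζ : C.Selection D) (g : (Fin n → D) → Fin k → D) :
    ∃ ξ : (selectMany k C).Selection D, ∀ x,
      (∀ p q, (selectMany k C).effects M ξ p q x = C.effects M ζ p q (Fin.append x (g x))) ∧
        (C.SelectsProperly M ζ (Fin.append x (g x)) →
          (selectMany k C).SelectsProperly M ξ x) := by
  induction k with
  | zero =>
    have h : ∀ x, Fin.append x (g x) = x := fun x => by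
      rw [Subsingleton.elim (g x) Fin.elim0, Fin.append_elim0]; rfl
    exact ⟨ζ, fun x => ⟨fun p q => by rw [h]; rfl, fun h' => by rw [h] at h'; exact h'⟩⟩
  | succ k ih =>
    -- The innermost `Select` provides the last component of `g x`. Its scope also holds the
    -- witnesses selected before it, so `x` is recovered from the first `n` coordinates.
    obtain ⟨ξ, hξ⟩ := ih (.select ⊤ C)
      (fun z => g (fun i => z (Fin.castAdd k i)) (Fin.last k), ζ) fun x => Fin.init (g x)
    have h : ∀ x, (Fin.snoc (Fin.append x (Fin.init (g x)))
        (g (fun i => Fin.append x (Fin.init (g x)) (Fin.castAdd k i)) (Fin.last k)) :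
          Fin (n + k + 1) → D) = Fin.append x (g x) := fun x => by
      simp only [Fin.append_left]
      rw [← Fin.append_snoc, Fin.snoc_init_self]
    refine ⟨ξ, fun x => ⟨fun p q => ((hξ x).1 p q).trans ?_, fun h' => (hξ x).2 ?_⟩⟩
    · ext a
      change Holds M ⊤ p q _ ∧ _ ↔ _
      rw [h]
      exact and_iff_right (holds_top M p q _)
    · refine ⟨fun h => h, ?_⟩
      dsimp only
      rw [h]
      exact h'

/-- `All` involves no choice, so `ζ` itself serves; `ξ` is existential because the two selection
types agree only after unfolding the recursion on `n`. -/
theorem exists_selection_allTrue (M : L.Structure D) {n : ℕ} (C : CEE L n) (ζ : C.Selection D) :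
    ∃ ξ : (allTrue n C).Selection D,
      (∀ p q a, a ∈ (allTrue n C).effects M ξ p q default ↔ ∃ x, a ∈ C.effects M ζ p q x) ∧
        ((∀ x, C.SelectsProperly M ζ x) → (allTrue n C).SelectsProperly M ξ default) := by
  induction n with
  | zero => exact ⟨ζ, fun p q a =>
      (Unique.exists_iff (p := fun x => a ∈ C.effects M ζ p q x)).symm, fun h => h _⟩
  | succ n ih =>
    obtain ⟨ξ, h₁, h₂⟩ := ih (.all ⊤ C) ζ
    refine ⟨ξ, fun p q a => (h₁ p q a).trans ⟨?_, ?_⟩, fun h => h₂ fun x d _ => h _⟩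
    · rintro ⟨x, d, -, h⟩
      exact ⟨_, h⟩
    · rintro ⟨x, h⟩
      refine ⟨Fin.init x, x (Fin.last n), holds_top M p q _, ?_⟩
      rwa [Fin.snoc_init_self]

theorem exists_selection_allMany (M : L.Structure D) {n : ℕ} (φ : L.BoundedFormula Empty n)
    (C : CEE L n) (ζ : C.Selection D) :
    ∃ ξ : (allMany n φ C).Selection D,
      (∀ p q a, a ∈ (allMany n φ C).effects M ξ p q default ↔
        ∃ x, Holds M φ p q x ∧ a ∈ C.effects M ζ p q x) ∧
        ((∀ x, C.SelectsProperly M ζ x) → (allMany n φ C).SelectsProperly M ξ default) := by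
  cases n with
  | zero =>
    exact ⟨ζ, fun p q a => (Unique.exists_iff (p := fun x => Holds M φ p q x ∧
      a ∈ C.effects M ζ p q x)).symm, fun h _ => h _⟩
  | succ n =>
    obtain ⟨ξ, h₁, h₂⟩ := exists_selection_allTrue M (.all φ C) ζ
    refine ⟨ξ, fun p q a => (h₁ p q a).trans ⟨?_, ?_⟩, fun h => h₂ fun x d _ => h _⟩
    · rintro ⟨x, d, h⟩
      exact ⟨_, h⟩
    · rintro ⟨x, h⟩
      refine ⟨Fin.init x, x (Fin.last n), ?_⟩
      rwa [Fin.snoc_init_self]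

/-- The instances of the head of `r` under the assignment `x` of the universal variables. -/
def Rule.headInstances (M : L.Structure D) (r : Rule L) (x : Fin r.nx → D) :
    Set (DomainAtom L D) :=
  {a | ∃ y : Fin r.ny → D, ∃ A ∈ r.head, A.eval M (Fin.append x y) = a}

theorem Rule.toCEE?_eq_none_iff (r : Rule L) : r.toCEE? = none ↔ r.head = [] := by
  unfold Rule.toCEE?
  split <;> simp_all

theorem exists_selection_toCEE? (M : L.Structure D) (r : Rule L) (C : CausalTheory L)
    (hC : r.toCEE? = some C) (c : (Fin r.nx → D) → DomainAtom L D)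
    (hc : ∀ x, c x ∈ r.headInstances M x) :
    ∃ ξ : C.Selection D,
      (∀ p q a, a ∈ C.effects M ξ p q default ↔ ∃ x, r.Fires M p q x ∧ a = c x) ∧
        C.SelectsProperly M ξ default := by
  choose y A hA hc using hc
  unfold Rule.toCEE? at hC
  split at hC
  · cases hC
  · next B Bs hB =>
    cases hC
    obtain ⟨ζ₁, h₁⟩ := exists_selection_orAtoms M B Bs
      (fun z => A fun i => z (Fin.castAdd r.ny i)) fun z => hB ▸ hA _
    obtain ⟨ζ₂, h₂⟩ := exists_selection_selectMany M _ ζ₁ y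
    obtain ⟨ζ₃, h₃, h₃'⟩ := exists_selection_allMany M r.body _ ζ₂
    refine ⟨ζ₃, fun p q a => (h₃ p q a).trans (exists_congr fun x => and_congr (holds_body ..) ?_),
      h₃' fun x => (h₂ x).2 (h₁ _).2⟩
    rw [(h₂ x).1, (h₁ _).1, Set.mem_singleton_iff]
    simp only [Fin.append_left]
    rw [hc]

/-- The choice `c` is defined on all rules with non-empty head, not only on those in `l`, so that
the induction can pass the same `c` to the tail. Constraints drop out of both sides. -/
theorem exists_selection_andList (M : L.Structure D)
    (c : ∀ r : Rule L, r.head ≠ [] → (Fin r.nx → D) → DomainAtom L D)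
    (hc : ∀ r h x, c r h x ∈ r.headInstances M x) (l : List (Rule L)) (C : CausalTheory L)
    (Cs : List (CausalTheory L)) (hl : l.filterMap Rule.toCEE? = C :: Cs) :
    ∃ ξ : (andList C Cs).Selection D,
      (∀ p q a, a ∈ (andList C Cs).effects M ξ p q default ↔
        ∃ r ∈ l, ∃ h : r.head ≠ [], ∃ x, r.Fires M p q x ∧ a = c r h x) ∧
        (andList C Cs).SelectsProperly M ξ default := by
  induction l generalizing C Cs with
  | nil => cases hl
  | cons r l ih =>
    cases hr : r.toCEE? with
    | none =>
      rw [List.filterMap_cons_none hr] at hl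
      obtain ⟨ξ, h₁, h₂⟩ := ih C Cs hl
      refine ⟨ξ, fun p q a => (h₁ p q a).trans ?_, h₂⟩
      simp [(Rule.toCEE?_eq_none_iff r).1 hr]
    | some C' =>
      have hne : r.head ≠ [] := fun h => by
        rw [(Rule.toCEE?_eq_none_iff r).2 h] at hr
        cases hr
      rw [List.filterMap_cons_some hr, List.cons.injEq] at hl
      obtain ⟨rfl, hl⟩ := hl
      obtain ⟨ζ, hζ, hζ'⟩ := exists_selection_toCEE? M r C' hr (c r hne) (hc r hne)
      cases Cs with
      | nil =>
        refine ⟨ζ, fun p q a => (hζ p q a).trans ?_, hζ'⟩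
        have hl' : ∀ s ∈ l, s.head = [] := fun s hs =>
          (Rule.toCEE?_eq_none_iff s).1 (List.filterMap_eq_nil_iff.1 hl s hs)
        constructor
        · exact fun h => ⟨r, List.mem_cons_self, hne, h⟩
        · rintro ⟨s, hs, h, hx⟩
          rcases List.mem_cons.1 hs with rfl | hs
          · exact hx
          · exact absurd (hl' s hs) h
      | cons C₂ Cs =>
        obtain ⟨ξ, h₁, h₂⟩ := ih C₂ Cs hl
        refine ⟨(ζ, ξ), fun p q a => ?_, hζ', h₂⟩
        refine (or_congr (hζ p q a) (h₁ p q a)).trans ?_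
        rw [List.exists_mem_cons_iff]
        exact or_congr_left ⟨fun h => ⟨hne, h⟩, fun ⟨_, h⟩ => h⟩

/-! ### Programs without recursion over negation -/

/-- The predicate `h` depends on the predicate `s` by a path with a negative edge. -/
def DependsThroughNegation (P : Program L) (h s : Pred L) : Prop :=
  ∃ h' s', Relation.ReflTransGen (DependsOn P) h h' ∧ DependsNegativelyOn P h' s' ∧
    Relation.ReflTransGen (DependsOn P) s' s

theorem DependsNegativelyOn.dependsOn {P : Program L} {h s : Pred L}
    (hs : DependsNegativelyOn P h s) : DependsOn P h s :=
  let ⟨r, hr, hh, hG⟩ := hs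
  ⟨r, hr, hh, .inr hG⟩

theorem DependsThroughNegation.trans {P : Program L} {h s t : Pred L}
    (hs : DependsThroughNegation P h s) (ht : DependsThroughNegation P s t) :
    DependsThroughNegation P h t :=
  let ⟨h', s', h₁, h₂, h₃⟩ := hs
  let ⟨_, _, k₁, k₂, k₃⟩ := ht
  ⟨h', s', h₁, h₂, h₃.trans (k₁.trans (k₃.head k₂.dependsOn))⟩

theorem DependsThroughNegation.irrefl {P : Program L} (hP : ¬ RecursionOverNegation P)
    (h : Pred L) : ¬ DependsThroughNegation P h h :=
  fun ⟨h', s', h₁, h₂, h₃⟩ => hP ⟨h', s', h₂, h₃.trans h₁⟩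

theorem finite_setOf_exists_dependsOn (P : Program L) : {s | ∃ h, DependsOn P h s}.Finite := by
  refine (P.finite_toSet.biUnion fun r _ =>
    (List.finite_toSet (r.pos.map Atom.symbol)).union
      (List.finite_toSet (r.neg.map Atom.symbol))).subset ?_
  rintro s ⟨h, r, hr, -, hs⟩
  simp only [Set.mem_iUnion]
  refine ⟨r, hr, ?_⟩
  simpa using hs

/-- The vocabulary may be infinite, but every predicate reached through negation occurs in a body of
the finite program. The relation is transitive and irreflexive, so the number of predicates reached
strictly decreases along it. -/
theorem wellFounded_dependsThroughNegation {P : Program L} (hP : ¬ RecursionOverNegation P) :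
    WellFounded fun s h => DependsThroughNegation P h s := by
  have hfin : ∀ h, {s | DependsThroughNegation P h s}.Finite := fun h => by
    refine (finite_setOf_exists_dependsOn P).subset ?_
    rintro s ⟨h', s', -, h₂, h₃⟩
    rcases Relation.ReflTransGen.cases_tail h₃ with rfl | ⟨t, -, ht⟩
    · exact ⟨h', h₂.dependsOn⟩
    · exact ⟨t, ht⟩
  refine Subrelation.wf (fun {s h} hs => ?_)
    (measure fun h => {s | DependsThroughNegation P h s}.ncard).wf
  exact Set.ncard_lt_ncard ⟨fun t ht => hs.trans ht,
    fun hsub => DependsThroughNegation.irrefl hP s (hsub hs)⟩ (hfin h)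

/-! ### Well-founded fixpoints -/

theorem step_stableStep (M : L.Structure D) (Δ : CausalTheory L) (ζ : Δ.Selection D)
    (q : Set (DomainAtom L D)) :
    step M Δ ζ (stableStep M Δ ζ q) q = stableStep M Δ ζ q :=
  OrderHom.map_lfp ⟨fun p => step M Δ ζ p q, fun _ _ hp => step_mono M Δ ζ hp subset_rfl⟩

theorem stableStep_subset {M : L.Structure D} {Δ : CausalTheory L} {ζ : Δ.Selection D}
    {p q : Set (DomainAtom L D)} (h : step M Δ ζ p q ⊆ p) : stableStep M Δ ζ q ⊆ p :=
  OrderHom.lfp_le ⟨fun p => step M Δ ζ p q, fun _ _ hp => step_mono M Δ ζ hp subset_rfl⟩ h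

/-- A program without recursion over negation has only total stable fixpoints. -/
theorem subset_of_stableStep_eq {P : Program L} (hP : ¬ RecursionOverNegation P)
    {M : L.Structure D} {Δ : CausalTheory L} {ζ : Δ.Selection D}
    {c : ∀ r : Rule L, r.head ≠ [] → (Fin r.nx → D) → DomainAtom L D}
    (hc : ∀ r h x, c r h x ∈ r.headInstances M x)
    (heff : ∀ p q a, a ∈ Δ.effects M ζ p q default ↔
      ∃ r ∈ P, ∃ h : r.head ≠ [], ∃ x, r.Fires M p q x ∧ a = c r h x)
    {l u : Set (DomainAtom L D)} (hl : stableStep M Δ ζ u = l) (hu : stableStep M Δ ζ l = u) :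
    u ⊆ l := by
  have hl' : step M Δ ζ l u = l := by rw [← hl]; exact step_stableStep M Δ ζ u
  -- The claim covers every predicate reachable from `s`, not `s` alone, so that it passes to
  -- positive bodies, which may be recursive; only negative edges descend in the induction.
  suffices ∀ s : Pred L, ∀ a ∈ u, Relation.ReflTransGen (DependsOn P) s a.symbol → a ∈ l from
    fun a ha => this _ a ha .refl
  intro s
  induction s using (wellFounded_dependsThroughNegation hP).induction with
  | _ s ih =>
  suffices u ⊆ {a | Relation.ReflTransGen (DependsOn P) s a.symbol → a ∈ l} from
    fun a ha => this ha
  -- `u` is the least set closed under `step` with negation read in `l`, so it suffices that the set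
  -- on the right is closed.
  conv_lhs => rw [← hu]
  apply stableStep_subset
  rintro a (ha | ha) hsa
  · rw [← hl']
    exact .inl ha
  · obtain ⟨r, hr, hne, x, hx, rfl⟩ := (heff ..).1 ha
    obtain ⟨y, A, hA, hAc⟩ := hc r hne x
    rw [← hl']
    refine .inr ((heff ..).2 ⟨r, hr, hne, x, ⟨fun B hB => ?_, fun G hG hGu => ?_⟩, rfl⟩)
    · exact hx.1 B hB (hsa.tail ⟨r, hr, ⟨A, hA, by rw [← hAc]; rfl⟩, .inl ⟨B, hB, rfl⟩⟩)
    -- The rule fires with `G` outside `l`, but outside `u` is needed; the induction hypothesis at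
    -- `G.symbol` carries `G` from `u` to `l`.
    · exact hx.2 G hG (ih _ ⟨_, G.symbol, hsa, ⟨r, hr, ⟨A, hA, by rw [← hAc]; rfl⟩, G, hG, rfl⟩,
        .refl⟩ _ hGu .refl)

theorem wellFounded_eq_of_stableStep_eq {P : Program L} (hP : ¬ RecursionOverNegation P)
    {M : L.Structure D} {Δ : CausalTheory L} {ζ : Δ.Selection D}
    {c : ∀ r : Rule L, r.head ≠ [] → (Fin r.nx → D) → DomainAtom L D}
    (hc : ∀ r h x, c r h x ∈ r.headInstances M x)
    (heff : ∀ p q a, a ∈ Δ.effects M ζ p q default ↔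
      ∃ r ∈ P, ∃ h : r.head ≠ [], ∃ x, r.Fires M p q x ∧ a = c r h x)
    {X : Set (DomainAtom L D)} (hX : stableStep M Δ ζ X = X) :
    wellFounded M Δ ζ = (X, OrderDual.toDual X) := by
  have hfix : stableRevision M Δ ζ (wellFounded M Δ ζ) = wellFounded M Δ ζ :=
    OrderHom.map_lfp _
  have hle : wellFounded M Δ ζ ≤ (X, OrderDual.toDual X) :=
    OrderHom.lfp_le _ (le_of_eq (Prod.ext hX (congrArg OrderDual.toDual hX)))
  generalize wellFounded M Δ ζ = I at hfix hle
  obtain ⟨l, u⟩ := I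
  -- In the precision order, lying below `(X, X)` means `l ⊆ X ⊆ u`; with `u ⊆ l` everything
  -- collapses to `X`.
  have hlX : l ⊆ X := hle.1
  have hXu : X ⊆ OrderDual.ofDual u := hle.2
  have hul : OrderDual.ofDual u ⊆ l := subset_of_stableStep_eq hP hc heff
    (congrArg Prod.fst hfix) (congrArg (fun J => OrderDual.ofDual (Prod.snd J)) hfix)
  exact Prod.ext (hlX.antisymm (hXu.trans hul))
    (congrArg OrderDual.toDual ((hul.trans hlX).antisymm hXu))

/-! ### Models of the corresponding theory -/

/-- If a choice of a head instance for every rule instance makes the true atoms of `M` the least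
set that contains the chosen atoms of the rule instances whose bodies hold, then `M` is a model of
the corresponding theory. -/
theorem isModel_correspondingTheory {P : Program L} (hP : ¬ RecursionOverNegation P)
    (M : L.Structure D)
    (c : ∀ r : Rule L, r.head ≠ [] → (Fin r.nx → D) → DomainAtom L D)
    (hc : ∀ r h x, c r h x ∈ r.headInstances M x)
    (hsat : ∀ r ∈ P, ∀ x, r.Fires M (atoms M) (atoms M) x → ∃ h : r.head ≠ [], c r h x ∈ atoms M)
    (hleast : ∀ X ⊆ atoms M,
      (∀ r ∈ P, ∀ h x, r.Fires M X (atoms M) x → c r h x ∈ X) → atoms M ⊆ X) :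
    (correspondingTheory P).IsModel M := by
  refine ⟨fun Δ hΔ => ?_, fun φ hφ => ?_⟩
  · change Δ ∈ causalPart P at hΔ
    unfold causalPart at hΔ
    split at hΔ
    · cases hΔ
    · next C Cs hl =>
      cases hΔ
      obtain ⟨ζ, heff, hζ⟩ := exists_selection_andList M c hc _ C Cs hl
      simp only [Finset.mem_toList] at heff
      refine ⟨ζ, wellFounded_eq_of_stableStep_eq hP hc heff ?_, hζ⟩
      have hsub : stableStep M (andList C Cs) ζ (atoms M) ⊆ atoms M := by
        apply stableStep_subset
        rintro a (ha | ha)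
        · exact ha.2
        · obtain ⟨r, hr, h, x, hx, rfl⟩ := (heff ..).1 ha
          exact (hsat r hr x hx).2
      refine hsub.antisymm (hleast _ hsub fun r hr h x hx => ?_)
      rw [← step_stableStep]
      exact .inr ((heff ..).2 ⟨r, hr, h, x, hx, rfl⟩)
  · rcases hφ with ⟨r, hr, hhead, rfl⟩ | ⟨s, hs, rfl⟩
    · refine BoundedFormula.realize_alls.2 fun x => BoundedFormula.realize_not.2 fun hx => ?_
      exact (hsat r hr x ((holds_body ..).1 ((holds_atoms_iff_realize ..).2 hx))).1 hhead
    · refine BoundedFormula.realize_alls.2 fun x => BoundedFormula.realize_not.2 fun hx => ?_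
      have hx' : (⟨s.1, s.2, x⟩ : DomainAtom L D) ∈ atoms M := hx
      -- No rule causes an atom of `s`, so deleting these atoms from `M` leaves a closed set, and
      -- leastness shows that there were none.
      refine (hleast {a ∈ atoms M | a.symbol ≠ s} (fun a ha => ha.1) (fun r hr h x hx => ?_) hx').2
        rfl
      refine ⟨(hsat r hr x (hx.mono (fun a ha => ha.1) subset_rfl)).2, ?_⟩
      obtain ⟨y, A, hA, hAc⟩ := hc r h x
      rw [← hAc]
      exact hs r hr A hA

theorem IsStableModel.isModel_correspondingTheory [Nonempty D] {P : Program L}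
    (hP : ¬ RecursionOverNegation P) {M : L.Structure D} (hM : IsStableModel P M) :
    (correspondingTheory P).IsModel M := by
  have hsat : ∀ r ∈ P, ∀ x, r.Fires M (atoms M) (atoms M) x →
      ∃ a ∈ r.headInstances M x, a ∈ atoms M := fun r hr x hx =>
    let ⟨y, A, hA, h⟩ := hM.prop r hr x ((entailsBody_iff_fires M subset_rfl r x).2 hx)
    ⟨_, ⟨y, A, hA, rfl⟩, h⟩
  have hex : ∀ r : Rule L, r.head ≠ [] → ∀ x, ∃ a ∈ r.headInstances M x,
      r ∈ P → r.Fires M (atoms M) (atoms M) x → a ∈ atoms M := by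
    intro r h x
    by_cases hx : r ∈ P ∧ r.Fires M (atoms M) (atoms M) x
    · obtain ⟨a, ha, ha'⟩ := hsat r hx.1 x hx.2
      exact ⟨a, ha, fun _ _ => ha'⟩
    · obtain ⟨A, hA⟩ := List.exists_mem_of_ne_nil _ h
      -- An instance that does not fire in `M` causes nothing, so its choice is arbitrary;
      -- non-emptiness of the domain supplies the values of `ȳ`.
      exact ⟨_, ⟨fun _ => Classical.arbitrary D, A, hA, rfl⟩, fun h₁ h₂ => absurd ⟨h₁, h₂⟩ hx⟩
  choose c hc hcM using hex
  have hne : ∀ r ∈ P, ∀ x, r.Fires M (atoms M) (atoms M) x → r.head ≠ [] := fun r hr x hx =>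
    let ⟨_, ⟨_, _, hA, _⟩, _⟩ := hsat r hr x hx
    List.ne_nil_of_mem hA
  refine CLog.isModel_correspondingTheory hP M c hc
    (fun r hr x hx => ⟨hne r hr x hx, hcM _ _ x hr hx⟩) fun X hX hcX => ?_
  -- A set closed under the chosen head instances contains some head instance of each entailed body,
  -- which is all that minimality asks for.
  refine hM.le_of_le (fun r hr x hx => ?_) hX
  have hx' := (entailsBody_iff_fires M hX r x).1 hx
  have h := hne r hr x (hx'.mono hX subset_rfl)
  obtain ⟨y, A, hA, hAc⟩ := hc r h x
  exact ⟨y, A, hA, hAc ▸ hcX r hr h x hx'⟩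

/-! ### A model that is not stable -/

/-- The vocabulary with a unary predicate as its only symbol. -/
def unaryLanguage : FirstOrder.Language.{0, 0} := ⟨fun _ => Empty, fun k => PLift (k = 1)⟩

/-- The predicate of `unaryLanguage`. -/
def unaryPred : unaryLanguage.Relations 1 := ⟨rfl⟩

/-- The rule `∀ x : ∃ y : P(y)`. -/
def existsRule : Rule unaryLanguage where
  nx := 1
  ny := 1
  head := [⟨1, unaryPred, fun _ => Term.var (Sum.inr 1)⟩]
  pos := []
  neg := []

/-- The structure over the vocabulary of a unary predicate that interprets it as `S`. -/
@[reducible]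
def unaryStructure (S : Set Bool) : unaryLanguage.Structure Bool where
  funMap f _ := f.elim
  RelMap R x := x ⟨0, R.down ▸ Nat.one_pos⟩ ∈ S

/-- The domain atom `P(b)`. -/
def unaryAtom (b : Bool) : DomainAtom unaryLanguage Bool := ⟨1, unaryPred, fun _ => b⟩

theorem atoms_unaryStructure (S : Set Bool) : atoms (unaryStructure S) = unaryAtom '' S := by
  ext ⟨k, ⟨rfl⟩, x⟩
  constructor
  · intro h
    refine ⟨x 0, h, ?_⟩
    have : (fun _ => x 0) = x := funext fun i => by rw [Subsingleton.elim i 0]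
    rw [unaryAtom, this]
    rfl
  · rintro ⟨b, hb, h⟩
    rw [← h]
    exact hb

theorem unaryAtom_injective : Function.Injective unaryAtom := fun b b' h => by
  obtain ⟨-, -, h⟩ := (DomainAtom.mk.injEq ..).mp h
  exact congrFun (eq_of_heq h) 0

theorem unaryAtom_mem_headInstances (M : unaryLanguage.Structure Bool) (x : Fin 1 → Bool)
    (b : Bool) : unaryAtom b ∈ existsRule.headInstances M x :=
  ⟨fun _ => b, _, List.mem_singleton.2 rfl, rfl⟩

theorem not_recursionOverNegation_existsRule : ¬ RecursionOverNegation {existsRule} := by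
  rintro ⟨h, s, ⟨r, hr, -, G, hG, -⟩, -⟩
  obtain rfl := Finset.mem_singleton.1 hr
  cases hG

/-- The variable `x` does not occur in the head, but it indexes the instances: letting instance `x`
select `f x` causes exactly the range of `f`. -/
theorem isModel_existsRule (f : Bool → Bool) :
    (correspondingTheory {existsRule}).IsModel (unaryStructure (Set.range f)) := by
  set M := unaryStructure (Set.range f)
  -- For a general `r` the index `0` need not exist in `Fin r.nx`; quantifying over `i` avoids a
  -- cast, and for `existsRule` the only index is `0`.
  have hex : ∀ r : Rule unaryLanguage, r.head ≠ [] → ∀ x, ∃ a ∈ r.headInstances M x,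
      ∀ i, r = existsRule → a = unaryAtom (f (x i)) := by
    intro r h x
    by_cases hr : r = existsRule
    · subst hr
      exact ⟨_, unaryAtom_mem_headInstances M x (f (x (0 : Fin 1))), fun i _ => by
        rw [Subsingleton.elim (α := Fin 1) i 0]⟩
    · obtain ⟨A, hA⟩ := List.exists_mem_of_ne_nil _ h
      exact ⟨_, ⟨fun _ => true, A, hA, rfl⟩, fun _ h => absurd h hr⟩
  choose c hc hcf using hex
  refine isModel_correspondingTheory not_recursionOverNegation_existsRule M c hc ?_ ?_
  · intro r hr x _
    obtain rfl := Finset.mem_singleton.1 hr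
    refine ⟨List.cons_ne_nil _ _, ?_⟩
    refine Set.mem_of_eq_of_mem (hcf existsRule _ x (0 : Fin 1) rfl) ?_
    rw [atoms_unaryStructure]
    exact ⟨_, ⟨_, rfl⟩, rfl⟩
  · intro X _ hcX
    rw [atoms_unaryStructure]
    rintro _ ⟨_, ⟨b, rfl⟩, rfl⟩
    have h := hcX existsRule (Finset.mem_singleton_self _) (List.cons_ne_nil _ _) (fun _ => b)
      ⟨fun _ h => (List.not_mem_nil h).elim, fun _ h => (List.not_mem_nil h).elim⟩
    exact Set.mem_of_eq_of_mem (hcf existsRule _ (fun _ => b) (0 : Fin 1) rfl).symm h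

theorem atoms_unaryStructure_ssubset :
    atoms (unaryStructure (Set.range fun _ : Bool => true)) ⊂ atoms (unaryStructure (Set.range id)) := by
  rw [atoms_unaryStructure, atoms_unaryStructure]
  refine unaryAtom_injective.image_strictMono ?_
  rw [Set.range_const, Set.range_id]
  refine Set.ssubset_univ_iff.2 ?_
  exact fun h => Bool.false_ne_true (h.ge (Set.mem_univ false))

/-- One true atom satisfies every instance of the rule, so the structure that selects `true`
throughout is a smaller closed set. -/
theorem not_isStableModel_existsRule :
    ¬ IsStableModel {existsRule} (unaryStructure (Set.range id)) := fun h => by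
  refine h.not_prop_of_lt atoms_unaryStructure_ssubset fun r hr x _ => ?_
  obtain rfl := Finset.mem_singleton.1 hr
  refine ⟨fun _ => true, _, List.mem_singleton.2 rfl, ?_⟩
  rw [atoms_unaryStructure]
  exact ⟨true, ⟨true, rfl⟩, rfl⟩

end CLog

theorem theorem3 :
    (∀ (L : FirstOrder.Language.{u, v}) (P : CLog.Program L), ¬ CLog.RecursionOverNegation P →
      ∀ (D : Type w) [Nonempty D] (M : L.Structure D),
        CLog.IsStableModel P M → (CLog.correspondingTheory P).IsModel M) ∧
    ∃ (L : FirstOrder.Language.{0, 0}) (P : CLog.Program L) (D : Type) (_ : Nonempty D)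
      (M M₀ : L.Structure D),
        ¬ CLog.RecursionOverNegation P ∧
        (CLog.correspondingTheory P).IsModel M ∧
        ¬ CLog.IsStableModel P M ∧
        (CLog.correspondingTheory P).IsModel M₀ ∧
        (∀ (k : ℕ) (f : L.Functions k) (x : Fin k → D), M₀.funMap f x = M.funMap f x) ∧
        CLog.atoms M₀ ⊂ CLog.atoms M := by
  refine ⟨fun L P hP D _ M hM => hM.isModel_correspondingTheory hP, CLog.unaryLanguage,
    {CLog.existsRule}, Bool, inferInstance, CLog.unaryStructure (Set.range id),
    CLog.unaryStructure (Set.range fun _ : Bool => true), CLog.not_recursionOverNegation_existsRule,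
    CLog.isModel_existsRule id, CLog.not_isStableModel_existsRule, CLog.isModel_existsRule _,
    fun k f => f.elim, CLog.atoms_unaryStructure_ssubset⟩
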